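/- **Proposition (area conservation and energy dissipation for the weak formulation of anisotropic surface diffusion).** Let $\mathbb T=\mathbb R/\mathbb Z=[0,1]$, and let $(a,b)^\perp=(b,-a)$ denote the clockwise rotation by $\pi/2$. Let $\gamma:\mathbb S^1\to\mathbb R$ be a surface energy density whose one-homogeneous extension $\gamma(\boldsymbol p)=|\boldsymbol p|\,\gamma(\boldsymbol p/|\boldsymbol p|)$, $\gamma(\boldsymbol 0)=0$, is $C^1$ on $\mathbb R^2\setminus\{\boldsymbol 0\}$, put $\boldsymbol\xi(\boldsymbol n)=\nabla\gamma(\boldsymbol p)|_{\boldsymbol p=\boldsymbol n}$, let $k:\mathbb S^1\to[0,\infty)$ be any function, and define the surface energy matrix $$\boldsymbol G_k(\boldsymbol n)=\gamma(\boldsymbol n)I_2-\boldsymbol n\boldsymbol\xi^T+\boldsymbol\xi\boldsymbol n^T+k(\boldsymbol n)\boldsymbol n\boldsymbol n^T,\qquad \boldsymbol n\in\mathbb S^1 .$$ For a closed curve $\Gamma(t)$ parametrized by $\boldsymbol X(\cdot,t)=(x(\cdot,t),y(\cdot,t))^T:\mathbb T\to\mathbb R^2$ write $\partial_\rho s=|\partial_\rho\boldsymbol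 X|$, $\partial_s=(\partial_\rho s)^{-1}\partial_\rho$, $\boldsymbol n=-(\partial_s\boldsymbol X)^\perp$ (the outward unit normal when the curve is simple and traversed clockwise), and $(u,v)_{\Gamma(t)}=\int_{\mathbb T}u\cdot v\,\partial_\rho s\,d\rho$. Let $\boldsymbol X(\cdot,t)\in[H^1(\mathbb T)]^2$ and $\mu(\cdot,t)\in H^1(\mathbb T)$, $t\ge 0$, be a solution of the variational formulation of anisotropic surface diffusion, that is: * $\boldsymbol X\in C([0,\infty);[H^1(\mathbb T)]^2)\cap W^{1,1}_{loc}((0,\infty);[H^1(\mathbb T)]^2)$; * the parametrization is regular: there is a constant $C>1$ with $\frac1C\le\partial_\rho s(\rho,t)\le C$ for all $t\ge0$ and almost every $\rho\in\mathbb T$; * for almost every $t>0$, $$\bigl(\boldsymbol n\cdot\partial_t\boldsymbol X,\varphi\bigr)_{\Gamma(t)}+\bigl(\partial_s\mu,\partial_s\varphi\bigr)_{\Gamma(t)}=0\qquad\forall\varphi\in H^1(\mathbb T),$$ $$\bigl(\mu\boldsymbol n,\boldsymbol\omega\bigr)_{\Gamma(t)}-\bigl(\boldsymbol G_k(\boldsymbol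 n)\partial_s\boldsymbol X,\partial_s\boldsymbol\omega\bigr)_{\Gamma(t)}=0\qquad\forall\boldsymbol\omega\in[H^1(\mathbb T)]^2 .$$ Let $$A(t)=\int_{\mathbb T}y(\rho,t)\,\partial_\rho x(\rho,t)\,d\rho,\qquad W(t)=\int_{\Gamma(t)}\gamma(\boldsymbol n)\,ds=\int_{\mathbb T}\gamma(\boldsymbol n)\,\partial_\rho s\,d\rho$$ be the enclosed area and the interfacial energy. Then $$A(t)=A(0)\quad\text{for all }t\ge0,\qquad W(t)\le W(t_1)\le W(0)\quad\text{for all }t\ge t_1\ge0 .$$ -/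

import Mathlib

namespace SurfaceDiffusion

open MeasureTheory Set
open scoped ContDiff

/-- The Euclidean plane `ℝ²`. -/
abbrev Plane : Type := EuclideanSpace ℝ (Fin 2)

/-- Lebesgue measure on the periodic interval `𝕋 = ℝ/ℤ = [0, 1]`. -/
noncomputable abbrev torusMeasure : Measure ℝ := volume.restrict (Ioc (0 : ℝ) 1)

/-- The Lebesgue space `L²(𝕋; E)`. -/
abbrev L2 (E : Type) [NormedAddCommGroup E] : Type := Lp E 2 torusMeasure

instance : IsProbabilityMeasure torusMeasure := ⟨by simp⟩

section Sobolev

variable {E : Type} [NormedAddCommGroup E] [NormedSpace ℝ E]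

/-- `g` is the weak derivative of `u` on the torus `𝕋`: integration by parts holds against all
smooth `1`-periodic test functions. -/
def IsWeakDeriv (u g : ℝ → E) : Prop :=
  ∀ φ : ℝ → ℝ, ContDiff ℝ ∞ φ → Function.Periodic φ 1 →
    ∫ ρ, deriv φ ρ • u ρ ∂torusMeasure = -∫ ρ, φ ρ • g ρ ∂torusMeasure

lemma exists_bound_torus {ψ : ℝ → ℝ} (hψ : Continuous ψ) :
    ∃ C : ℝ, ∀ᵐ ρ ∂torusMeasure, ‖ψ ρ‖ ≤ C := by
  obtain ⟨C, hC⟩ := (isCompact_Icc (a := (0 : ℝ)) (b := 1)).exists_bound_of_continuousOn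
    hψ.continuousOn
  refine ⟨C, ?_⟩
  filter_upwards [ae_restrict_mem measurableSet_Ioc] with ρ hρ
  exact hC ρ ⟨hρ.1.le, hρ.2⟩

lemma integrable_smul_L2 {ψ : ℝ → ℝ} (hψ : Continuous ψ) (u : L2 E) :
    Integrable (fun ρ => ψ ρ • u ρ) torusMeasure := by
  obtain ⟨C, hC⟩ := exists_bound_torus hψ
  exact ((Lp.memLp u).integrable one_le_two).bdd_smul C hψ.aestronglyMeasurable hC

/-- Pairing with a continuous function, as a continuous linear functional on `L²(𝕋; E)`. -/
noncomputable def pairing (ψ : ℝ → ℝ) (hψ : Continuous ψ) : L2 E →L[ℝ] E :=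
  LinearMap.mkContinuousOfExistsBound
    { toFun := fun u => ∫ ρ, ψ ρ • u ρ ∂torusMeasure
      map_add' := by
        intro u v
        rw [← integral_add (integrable_smul_L2 hψ u) (integrable_smul_L2 hψ v)]
        refine integral_congr_ae ?_
        filter_upwards [Lp.coeFn_add u v] with ρ h
        rw [h, Pi.add_apply, smul_add]
      map_smul' := by
        intro c u
        rw [RingHom.id_apply, ← integral_smul]
        refine integral_congr_ae ?_
        filter_upwards [Lp.coeFn_smul c u] with ρ h
        rw [h, Pi.smul_apply, smul_comm] }
    (by
      obtain ⟨C, hC⟩ := exists_bound_torus hψ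
      refine ⟨C, fun u => ?_⟩
      have hC0 : 0 ≤ C := by
        obtain ⟨ρ, h⟩ := hC.exists
        exact (norm_nonneg _).trans h
      have hi : Integrable (fun ρ => u ρ) torusMeasure := (Lp.memLp u).integrable one_le_two
      calc ‖∫ ρ, ψ ρ • u ρ ∂torusMeasure‖ ≤ ∫ ρ, C * ‖u ρ‖ ∂torusMeasure := by
            refine norm_integral_le_of_norm_le (hi.norm.const_mul C) ?_
            filter_upwards [hC] with ρ h
            rw [norm_smul]
            gcongr
        _ = C * ∫ ρ, ‖u ρ‖ ∂torusMeasure := integral_const_mul _ _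
        _ ≤ C * ‖u‖ := by
            refine mul_le_mul_of_nonneg_left ?_ hC0
            rw [integral_norm_eq_lintegral_enorm hi.aestronglyMeasurable,
              ← eLpNorm_one_eq_lintegral_enorm, Lp.norm_def]
            exact ENNReal.toReal_mono (Lp.eLpNorm_ne_top u)
              (eLpNorm_le_eLpNorm_of_exponent_le one_le_two hi.aestronglyMeasurable))

lemma isWeakDeriv_iff (u g : L2 E) : IsWeakDeriv u g ↔
    ∀ (φ : ℝ → ℝ) (h : ContDiff ℝ ∞ φ), Function.Periodic φ 1 →
      pairing (deriv φ) (h.continuous_deriv (by simp)) u + pairing φ h.continuous g = 0 := by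
  simp only [add_eq_zero_iff_eq_neg]
  rfl

variable (E) in
/-- The Sobolev space `H¹(𝕋; E)`, realised as the space of pairs `(u, ∂_ρ u)` in `L² × L²` such
that the second entry is the weak derivative of the first one, with the usual norm
`‖u‖² = ‖u‖²_{L²} + ‖∂_ρ u‖²_{L²}`. -/
noncomputable def H1 : Submodule ℝ (WithLp 2 (L2 E × L2 E)) where
  carrier := {p | IsWeakDeriv (p.fst : ℝ → E) (p.snd : ℝ → E)}
  zero_mem' := by
    refine (isWeakDeriv_iff _ _).2 fun φ h _ => ?_
    simp
  add_mem' := by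
    intro p q hp hq
    refine (isWeakDeriv_iff _ _).2 fun φ h hφ => ?_
    have h1 := (isWeakDeriv_iff _ _).1 hp φ h hφ
    have h2 := (isWeakDeriv_iff _ _).1 hq φ h hφ
    simp only [WithLp.add_fst, WithLp.add_snd, map_add]
    rw [add_add_add_comm, h1, h2, add_zero]
  smul_mem' := by
    intro c p hp
    refine (isWeakDeriv_iff _ _).2 fun φ h hφ => ?_
    have h1 := (isWeakDeriv_iff _ _).1 hp φ h hφ
    simp only [WithLp.smul_fst, WithLp.smul_snd, map_smul]
    rw [← smul_add, h1, smul_zero]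

lemma isClosed_H1 : IsClosed (H1 E : Set (WithLp 2 (L2 E × L2 E))) := by
  have : (H1 E : Set (WithLp 2 (L2 E × L2 E))) =
      ⋂ (φ : ℝ → ℝ) (h : ContDiff ℝ ∞ φ) (_ : Function.Periodic φ 1),
        {p | pairing (deriv φ) (h.continuous_deriv (by simp)) p.fst
          + pairing φ h.continuous p.snd = 0} := by
    ext p
    simp only [mem_iInter, mem_ofPred_eq]
    exact isWeakDeriv_iff _ _
  rw [this]
  refine isClosed_iInter fun φ => isClosed_iInter fun h => isClosed_iInter fun _ =>
    isClosed_eq ?_ continuous_const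
  have h1 : Continuous fun p : WithLp 2 (L2 E × L2 E) => p.fst :=
    (WithLp.fstL 2 ℝ (L2 E) (L2 E)).continuous
  have h2 : Continuous fun p : WithLp 2 (L2 E × L2 E) => p.snd :=
    (WithLp.sndL 2 ℝ (L2 E) (L2 E)).continuous
  fun_prop

instance [CompleteSpace E] : CompleteSpace (H1 E) :=
  (isClosed_H1 (E := E)).completeSpace_coe

/-- The underlying (almost everywhere defined) function `u` of an element of `H¹(𝕋; E)`. -/
noncomputable def fn (u : H1 E) : ℝ → E :=
  ((u : WithLp 2 (L2 E × L2 E)).fst : ℝ → E)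

/-- The weak derivative `∂_ρ u` of an element of `H¹(𝕋; E)`. -/
noncomputable def dρ (u : H1 E) : ℝ → E :=
  ((u : WithLp 2 (L2 E × L2 E)).snd : ℝ → E)

end Sobolev

/-- Clockwise rotation by `π/2`: `(a, b)^⊥ = (b, -a)`. -/
noncomputable def perp (v : Plane) : Plane := !₂[v 1, -v 0]

section Anisotropy

/-- The one-homogeneous extension `γ(p) = |p| γ(p/|p|)`, `γ(0) = 0`, of the restriction of `γ` to
the unit circle; it does not depend on the values of `γ` off the unit circle. -/
noncomputable def homExt (γ : Plane → ℝ) (p : Plane) : ℝ := ‖p‖ * γ (‖p‖⁻¹ • p)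

/-- The Cahn-Hoffman vector `ξ(n) = ∇γ(p)|_{p = n}`. -/
noncomputable def cahnHoffman (γ : Plane → ℝ) (n : Plane) : Plane := gradient (homExt γ) n

/-- The surface energy matrix `G_k(n) = γ(n) I₂ - n ξᵀ + ξ nᵀ + k(n) n nᵀ`. -/
noncomputable def surfaceEnergyMatrix (γ k : Plane → ℝ) (n : Plane) :
    Matrix (Fin 2) (Fin 2) ℝ :=
  γ n • (1 : Matrix (Fin 2) (Fin 2) ℝ) - Matrix.vecMulVec n (cahnHoffman γ n)
    + Matrix.vecMulVec (cahnHoffman γ n) n + k n • Matrix.vecMulVec n n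

end Anisotropy

section Curve

variable {E : Type} [NormedAddCommGroup E] [NormedSpace ℝ E]

/-- `∂_ρ s = |∂_ρ X|`, the density of the arc length of the curve `X` with respect to `ρ`. -/
noncomputable def arcDensity (X : H1 Plane) (ρ : ℝ) : ℝ := ‖dρ X ρ‖

/-- The arc-length derivative `∂_s u = ∂_ρ u / ∂_ρ s` along the curve `X`. -/
noncomputable def ds (X : H1 Plane) (u : H1 E) (ρ : ℝ) : E := (arcDensity X ρ)⁻¹ • dρ u ρ

/-- The unit normal `n` of the curve `X`, that is `n = -(∂_s X)^⊥`, so that the unit tangent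
is `τ = ∂_s X = n^⊥`. It is the outward one for a simple closed curve that is traversed
clockwise. -/
noncomputable def normal (X : H1 Plane) (ρ : ℝ) : Plane := -perp (ds X X ρ)

/-- The weighted inner product `(u, v)_Γ = ∫_Γ u · v ds = ∫_𝕋 u · v ∂_ρ s dρ`. -/
noncomputable def curveInner {F : Type} [NormedAddCommGroup F] [InnerProductSpace ℝ F]
    (X : H1 Plane) (u v : ℝ → F) : ℝ :=
  ∫ ρ, inner ℝ (u ρ) (v ρ) * arcDensity X ρ ∂torusMeasure

/-- The enclosed area `A = ∫_𝕋 y ∂_ρ x dρ` of the curve `X = (x, y)`. -/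
noncomputable def area (X : H1 Plane) : ℝ := ∫ ρ, fn X ρ 1 * dρ X ρ 0 ∂torusMeasure

/-- The interfacial energy `W = ∫_Γ γ(n) ds`. -/
noncomputable def energy (γ : Plane → ℝ) (X : H1 Plane) : ℝ :=
  ∫ ρ, γ (normal X ρ) * arcDensity X ρ ∂torusMeasure

end Curve

/-- `V` is the time derivative `∂_t X` on `(0, ∞)` of a curve `X` in a normed space, in the sense of
`W^{1,1}_loc`: it is locally (Bochner) integrable and `X` is a primitive of it. -/
def IsTimeDeriv {F : Type} [NormedAddCommGroup F] [NormedSpace ℝ F] (X V : ℝ → F) : Prop :=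
  ∀ a b : ℝ, 0 < a → a ≤ b →
    IntervalIntegrable V volume a b ∧ X b - X a = ∫ t in a..b, V t

/-- The two equations of the variational formulation at a fixed time, for the curve `X`, its
velocity `V = ∂_t X` and the weighted curvature `μ`. -/
def WeakEquations (γ k : Plane → ℝ) (X V : H1 Plane) (μ : H1 ℝ) : Prop :=
  (∀ φ : H1 ℝ,
    curveInner X (fun ρ => inner ℝ (normal X ρ) (fn V ρ)) (fn φ)
      + curveInner X (ds X μ) (ds X φ) = 0) ∧
  (∀ η : H1 Plane,
    curveInner X (fun ρ => fn μ ρ • normal X ρ) (fn η)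
      - curveInner X
          (fun ρ => Matrix.toEuclideanLin (surfaceEnergyMatrix γ k (normal X ρ)) (ds X X ρ))
          (ds X η) = 0)

/-- `(X, μ)` is a solution on `[0, ∞)` of the variational formulation of anisotropic surface
diffusion: `X(·, t) ∈ [H¹(𝕋)]²` depends continuously on `t ≥ 0` and has a time derivative in
`[H¹(𝕋)]²`, `μ(·, t) ∈ H¹(𝕋)`, the parametrization is regular during the evolution, and the two
equations hold for almost every `t > 0`. -/
structure IsWeakSolution (γ k : Plane → ℝ) (X : ℝ → H1 Plane) (μ : ℝ → H1 ℝ) : Prop where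
  continuousOn : ContinuousOn X (Ici 0)
  regular : ∃ C : ℝ, 1 < C ∧ ∀ t : ℝ, 0 ≤ t → ∀ᵐ ρ ∂torusMeasure,
    1 / C ≤ arcDensity (X t) ρ ∧ arcDensity (X t) ρ ≤ C
  equations : ∃ V : ℝ → H1 Plane, IsTimeDeriv X V ∧
    ∀ᵐ t ∂(volume.restrict (Ioi (0 : ℝ))), WeakEquations γ k (X t) (V t) (μ t)

end SurfaceDiffusion

/-!
Both functionals are locally Lipschitz on `H¹` and have directional derivatives, so along the
absolutely continuous curve `t ↦ X(t)` they are absolutely continuous and the chain rule holds for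
almost every `t`; no second derivative of `X` in space is ever needed.

For the area, `A(X) = ⟨y, ∂_ρ x⟩` is a continuous quadratic form, and integration by parts on `𝕋`
(read off from the Fourier coefficients) shows `dA(X)[V] = (n · V, 1)_Γ`, which vanishes by the
first equation with `φ = 1`.

For the energy, one-homogeneity gives `W(X) = ∫ γ(-(∂_ρ X)^⊥) dρ` with a Lipschitz integrand.
Euler's identity `γ(n) = ξ(n) · n` and `∂_s X ⊥ n` show `dW(X)[V] = (G_k(n) ∂_s X, ∂_s V)_Γ`. The
equations tested with `ω = V` and `φ = μ` turn this into `-(∂_s μ, ∂_s μ)_Γ ≤ 0`.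
-/

namespace SurfaceDiffusion

open MeasureTheory Set Filter Topology
open scoped ContDiff NNReal

section Evolution

lemma hasDerivAt_comp_of_hasLineDerivAt {G H : Type*} [NormedAddCommGroup G] [NormedSpace ℝ G]
    [NormedAddCommGroup H] [NormedSpace ℝ H] {F : H → G} {K : ℝ≥0} {U : Set H} {c : ℝ → H}
    {t : ℝ} {v : H} {f' : G} (hF : LipschitzOnWith K F U) (hU : U ∈ 𝓝 (c t))
    (hc : HasDerivAt c v t) (hline : HasLineDerivAt ℝ F f' (c t) v) :
    HasDerivAt (fun s => F (c s)) f' t := by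
  have htangent : HasDerivAt (fun s => F (c t + (s - t) • v)) f' t := by
    rw [HasLineDerivAt, ← sub_self t] at hline
    exact hline.comp_sub_const t t
  have hnear : ∀ᶠ s in 𝓝 t, c t + (s - t) • v ∈ U := by
    have hcont : ContinuousAt (fun s : ℝ => c t + (s - t) • v) t := by fun_prop
    exact hcont (by simpa using hU)
  have hsub : HasDerivAt (fun s => F (c s) - F (c t + (s - t) • v)) 0 t := by
    rw [hasDerivAt_iff_isLittleO]
    refine (Asymptotics.IsBigO.of_bound K ?_).trans_isLittleO (hasDerivAt_iff_isLittleO.1 hc)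
    filter_upwards [hc.continuousAt hU, hnear] with s hcs hs
    simpa [dist_eq_norm, sub_sub] using hF.dist_le_mul _ hcs _ hs
  simpa only [sub_add_cancel, zero_add] using hsub.fun_add htangent

lemma absolutelyContinuousOnInterval_of_dist_le_mul {Y Z : Type*} [PseudoMetricSpace Y]
    [PseudoMetricSpace Z] {f : ℝ → Y} {g : ℝ → Z} {K a b : ℝ}
    (hg : AbsolutelyContinuousOnInterval g a b)
    (hfg : ∀ s ∈ uIcc a b, ∀ t ∈ uIcc a b, dist (f s) (f t) ≤ K * dist (g s) (g t)) :
    AbsolutelyContinuousOnInterval f a b := by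
  have hlim := Filter.Tendsto.const_mul K hg
  rw [mul_zero] at hlim
  refine squeeze_zero' (Eventually.of_forall fun E => Finset.sum_nonneg fun i _ => dist_nonneg)
    ?_ hlim
  filter_upwards [mem_inf_of_right (mem_principal_self _)] with E hE
  rw [Finset.mul_sum]
  exact Finset.sum_le_sum fun i hi => hfg _ (hE.1 i hi).1 _ (hE.1 i hi).2

namespace IsTimeDeriv

variable {H : Type} [NormedAddCommGroup H] [NormedSpace ℝ H] {X V : ℝ → H} {a b : ℝ}

lemma absolutelyContinuousOnInterval (h : IsTimeDeriv X V) (ha : 0 < a) (hab : a ≤ b) :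
    AbsolutelyContinuousOnInterval X a b := by
  have hV : IntervalIntegrable (fun t => ‖V t‖) volume a b := (h a b ha hab).1.norm
  refine absolutelyContinuousOnInterval_of_dist_le_mul (K := 1)
    (hV.absolutelyContinuousOnInterval_intervalIntegral (c := a) left_mem_uIcc) ?_
  have hsub : ∀ t ∈ Icc a b, IntervalIntegrable (fun r => ‖V r‖) volume a t := fun t ht =>
    hV.mono_set (uIcc_subset_uIcc_left (by rwa [uIcc_of_le hab]))
  have hle : ∀ s ∈ Icc a b, ∀ t ∈ Icc a b, s ≤ t →
      dist (X s) (X t) ≤ 1 * dist (∫ r in a..s, ‖V r‖) (∫ r in a..t, ‖V r‖) := by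
    intro s hs t ht hst
    rw [one_mul, dist_comm, dist_comm (∫ r in a..s, ‖V r‖), dist_eq_norm, dist_eq_norm,
      (h s t (ha.trans_le hs.1) hst).2,
      intervalIntegral.integral_interval_sub_left (hsub t ht) (hsub s hs)]
    exact (intervalIntegral.norm_integral_le_integral_norm hst).trans (Real.le_norm_self _)
  rw [uIcc_of_le hab]
  intro s hs t ht
  rcases le_total s t with hst | hts
  · exact hle s hs t ht hst
  · simpa only [dist_comm] using hle t ht s hs hts

lemma ae_hasDerivAt [CompleteSpace H] (h : IsTimeDeriv X V) (ha : 0 < a) (hab : a ≤ b) :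
    ∀ᵐ t, t ∈ Ioo a b → HasDerivAt X (V t) t := by
  filter_upwards [(h a b ha hab).1.ae_hasDerivAt_integral] with t hderiv ht
  have htab : t ∈ uIcc a b := Icc_subset_uIcc (Ioo_subset_Icc_self ht)
  refine ((hderiv htab a left_mem_uIcc).const_add (X a)).congr_of_eventuallyEq ?_
  filter_upwards [Ioi_mem_nhds ht.1] with s hs
  rw [← (h a s ha (mem_Ioi.1 hs).le).2, add_sub_cancel]

lemma sub_eq_integral [CompleteSpace H] (h : IsTimeDeriv X V) {F : H → ℝ} {f' : ℝ → ℝ}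
    (hF : LocallyLipschitz F)
    (hline : ∀ᵐ t ∂volume.restrict (Ioi 0), HasLineDerivAt ℝ F (f' t) (X t) (V t))
    (ha : 0 < a) (hab : a ≤ b) : F (X b) - F (X a) = ∫ t in a..b, f' t := by
  have hX : AbsolutelyContinuousOnInterval X a b := h.absolutelyContinuousOnInterval ha hab
  obtain ⟨K, hK⟩ := hF.locallyLipschitzOn.exists_lipschitzOnWith_of_compact
    (isCompact_uIcc.image_of_continuousOn hX.continuousOn)
  have hFX : AbsolutelyContinuousOnInterval (fun t => F (X t)) a b :=
    absolutelyContinuousOnInterval_of_dist_le_mul hX fun s hs t ht =>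
      hK.dist_le_mul _ (mem_image_of_mem X hs) _ (mem_image_of_mem X ht)
  rw [← hFX.integral_deriv_eq_sub, intervalIntegral.integral_of_le hab,
    intervalIntegral.integral_of_le hab, integral_Ioc_eq_integral_Ioo, integral_Ioc_eq_integral_Ioo]
  refine setIntegral_congr_ae measurableSet_Ioo ?_
  filter_upwards [h.ae_hasDerivAt ha hab, (ae_restrict_iff' measurableSet_Ioi).1 hline]
    with t hderiv hlinet ht
  obtain ⟨L, U, hU, hL⟩ := hF (X t)
  exact (hasDerivAt_comp_of_hasLineDerivAt hL hU (hderiv ht) (hlinet (ha.trans ht.1))).deriv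

end IsTimeDeriv

lemma antitoneOn_Ici_of_Ioi {α β : Type*} [LinearOrder α] [TopologicalSpace α] [OrderTopology α]
    [DenselyOrdered α] [Preorder β] [TopologicalSpace β] [ClosedIciTopology β] {f : α → β} {a : α}
    (hf : ContinuousOn f (Ici a)) (hanti : AntitoneOn f (Ioi a)) : AntitoneOn f (Ici a) := by
  intro s hs t ht hst
  rcases (mem_Ici.1 hs).eq_or_lt with rfl | has
  · rcases hst.eq_or_lt with rfl | hat
    · exact le_rfl
    · have hlim : Tendsto f (𝓝[>] a) (𝓝 (f a)) := (hf a hs).mono_left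
        (nhdsWithin_mono a Ioi_subset_Ici_self)
      have : (𝓝[>] a).NeBot := nhdsGT_neBot_of_exists_gt ⟨t, hat⟩
      refine ge_of_tendsto hlim ?_
      filter_upwards [Ioc_mem_nhdsGT hat] with r hr
      exact hanti hr.1 hat hr.2
  · exact hanti has (has.trans_le hst) hst

end Evolution

section Homogeneous

variable {G F : Type*} [NormedAddCommGroup G] [NormedSpace ℝ G] [NormedAddCommGroup F]
  [NormedSpace ℝ F]

/-- A map is positively homogeneous (of degree one) if it commutes with scaling by positive
reals. -/
def IsPosHomogeneous (h : G → F) : Prop := ∀ ⦃c : ℝ⦄, 0 < c → ∀ p, h (c • p) = c • h p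

namespace IsPosHomogeneous

variable {h : G → F}

lemma map_zero (hh : IsPosHomogeneous h) : h 0 = 0 := by
  have h2 : h 0 = (2 : ℝ) • h 0 := by simpa using hh two_pos 0
  simpa [two_smul] using h2

lemma fderiv_smul (hh : IsPosHomogeneous h) {c : ℝ} (hc : 0 < c) (p : G) :
    fderiv ℝ h (c • p) = fderiv ℝ h p := by
  have hscale : c • fderiv ℝ h (c • p) = c • fderiv ℝ h p := by
    rw [← fderiv_comp_smul, funext (hh hc)]
    exact congrFun (fderiv_const_smul_field c) p
  exact smul_right_injective _ hc.ne' hscale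

lemma fderiv_apply_self (hh : IsPosHomogeneous h) {p : G} (hp : DifferentiableAt ℝ h p) :
    fderiv ℝ h p p = h p := by
  have hline : HasDerivAt (fun t : ℝ => h (p + t • p)) (fderiv ℝ h p p) 0 :=
    hp.hasFDerivAt.hasLineDerivAt p
  have hlinear : HasDerivAt (fun t : ℝ => (1 + t) • h p) ((1 : ℝ) • h p) 0 :=
    ((hasDerivAt_id (0 : ℝ)).const_add 1).smul_const (h p)
  have heq : (fun t : ℝ => h (p + t • p)) =ᶠ[𝓝 0] fun t : ℝ => (1 + t) • h p := by
    filter_upwards [Ioi_mem_nhds neg_one_lt_zero] with t ht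
    rw [← hh (neg_lt_iff_pos_add'.1 ht), add_smul, one_smul]
  rw [hline.unique (hlinear.congr_of_eventuallyEq heq), one_smul]

lemma exists_norm_fderiv_le [ProperSpace G] (hh : IsPosHomogeneous h)
    (hC1 : ContDiffOn ℝ 1 h {0}ᶜ) : ∃ L : ℝ≥0, ∀ p ≠ 0, ‖fderiv ℝ h p‖ ≤ L := by
  have hcont : ContinuousOn (fderiv ℝ h) {0}ᶜ :=
    hC1.continuousOn_fderiv_of_isOpen isOpen_compl_singleton le_rfl
  obtain ⟨L, hL⟩ := (isCompact_sphere (0 : G) 1).exists_bound_of_continuousOn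
    (hcont.mono fun p hp => ne_zero_of_mem_unit_sphere ⟨p, hp⟩)
  refine ⟨L.toNNReal, fun p hp => le_trans ?_ (Real.le_coe_toNNReal L)⟩
  rw [← hh.fderiv_smul (inv_pos.2 (norm_pos_iff.2 hp))]
  exact hL _ (by simp [norm_smul, hp])

/-- On a segment through the origin, where `h` need not be differentiable, the estimate
`‖h p‖ ≤ L ‖p‖` replaces the mean value inequality. -/
lemma exists_lipschitzWith [ProperSpace G] (hh : IsPosHomogeneous h)
    (hC1 : ContDiffOn ℝ 1 h {0}ᶜ) : ∃ L : ℝ≥0, LipschitzWith L h := by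
  have hdiff : ∀ p ≠ 0, DifferentiableAt ℝ h p := fun p hp =>
    (hC1.differentiableOn one_ne_zero).differentiableAt (isOpen_compl_singleton.mem_nhds hp)
  obtain ⟨L, hL⟩ := hh.exists_norm_fderiv_le hC1
  have hgrowth : ∀ p, ‖h p‖ ≤ L * ‖p‖ := by
    intro p
    rcases eq_or_ne p 0 with rfl | hp
    · simp [hh.map_zero]
    · rw [← hh.fderiv_apply_self (hdiff p hp)]
      exact ContinuousLinearMap.le_of_opNorm_le _ (hL p hp) p
  refine ⟨L, LipschitzWith.of_dist_le_mul fun p q => ?_⟩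
  by_cases hzero : (0 : G) ∈ segment ℝ p q
  · rw [← dist_add_dist_of_mem_segment hzero, dist_zero_right, dist_zero_left, mul_add,
      dist_eq_norm]
    exact (norm_sub_le _ _).trans (add_le_add (hgrowth p) (hgrowth q))
  · have hne : ∀ x ∈ segment ℝ p q, x ≠ 0 := fun x hx h0 => hzero (h0 ▸ hx)
    rw [dist_comm, dist_comm p, dist_eq_norm, dist_eq_norm]
    exact (convex_segment p q).norm_image_sub_le_of_norm_fderiv_le
      (fun x hx => hdiff x (hne x hx)) (fun x hx => hL x (hne x hx))
      (left_mem_segment ℝ p q) (right_mem_segment ℝ p q)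

end IsPosHomogeneous

end Homogeneous

section IntegralFunctional

variable {α E F : Type*} [MeasurableSpace α] {ν : Measure α} [NormedAddCommGroup E]
  [NormedAddCommGroup F] {Φ : E → F} {L : ℝ≥0} {f g : α → E}

lemma integrable_comp_of_lipschitzWith (hΦ : LipschitzWith L Φ) (hΦ0 : Φ 0 = 0)
    (hf : Integrable f ν) : Integrable (fun x => Φ (f x)) ν :=
  memLp_one_iff_integrable.1 (hΦ.comp_memLp hΦ0 (memLp_one_iff_integrable.2 hf))

lemma hasDerivAt_integral_comp_add_smul [NormedSpace ℝ E] [NormedSpace ℝ F]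
    (hΦ : LipschitzWith L Φ) (hΦ0 : Φ 0 = 0) (hf : Integrable f ν) (hg : Integrable g ν)
    {Φ' : α → F} (hline : ∀ᵐ x ∂ν, HasLineDerivAt ℝ Φ (Φ' x) (f x) (g x)) :
    HasDerivAt (fun t : ℝ => ∫ x, Φ (f x + t • g x) ∂ν) (∫ x, Φ' x ∂ν) 0 := by
  have hint : ∀ t : ℝ, Integrable (fun x => Φ (f x + t • g x)) ν := fun t =>
    integrable_comp_of_lipschitzWith hΦ hΦ0 (hf.add (hg.smul t))
  have hΦ' : AEStronglyMeasurable Φ' ν := by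
    refine aestronglyMeasurable_of_tendsto_ae (𝓝[≠] (0 : ℝ))
      (f := fun t x => t⁻¹ • (Φ (f x + t • g x) - Φ (f x)))
      (fun t => ((hint t).1.sub (hΦ.continuous.comp_aestronglyMeasurable hf.1)).const_smul t⁻¹) ?_
    filter_upwards [hline] with x hx using hx.tendsto_slope_zero
  refine (hasDerivAt_integral_of_dominated_loc_of_lip (F := fun t x => Φ (f x + t • g x))
    (bound := fun x => L * ‖g x‖) univ_mem (Eventually.of_forall fun t => (hint t).1) (hint 0) hΦ'
    (Eventually.of_forall fun x => LipschitzOnWith.of_dist_le_mul fun s _ t _ => ?_)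
    (hg.norm.const_mul _) hline).2
  refine (hΦ.dist_le_mul _ _).trans_eq ?_
  rw [dist_add_left, dist_eq_norm, ← sub_smul, norm_smul, Real.coe_nnabs,
    abs_of_nonneg (by positivity), dist_eq_norm]
  ring

lemma dist_integral_comp_le [NormedSpace ℝ F] (hΦ : LipschitzWith L Φ) (hΦ0 : Φ 0 = 0)
    (hf : Integrable f ν) (hg : Integrable g ν) :
    dist (∫ x, Φ (f x) ∂ν) (∫ x, Φ (g x) ∂ν) ≤ L * ∫ x, ‖f x - g x‖ ∂ν := by
  rw [dist_eq_norm, ← integral_sub (integrable_comp_of_lipschitzWith hΦ hΦ0 hf)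
    (integrable_comp_of_lipschitzWith hΦ hΦ0 hg), ← integral_const_mul]
  refine norm_integral_le_of_norm_le ((hf.sub hg).norm.const_mul _)
    (Eventually.of_forall fun x => ?_)
  simpa [dist_eq_norm] using hΦ.dist_le_mul (f x) (g x)

end IntegralFunctional

section Sobolev

variable {E F : Type} [NormedAddCommGroup E] [NormedSpace ℝ E] [NormedAddCommGroup F]
  [NormedSpace ℝ F]

namespace IsWeakDeriv

variable {u u' g g' : ℝ → E}

lemma congr_ae (h : IsWeakDeriv u g) (hu : u =ᵐ[torusMeasure] u') (hg : g =ᵐ[torusMeasure] g') :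
    IsWeakDeriv u' g' := by
  intro φ hφ hper
  have hleft : ∫ ρ, deriv φ ρ • u ρ ∂torusMeasure = ∫ ρ, deriv φ ρ • u' ρ ∂torusMeasure :=
    integral_congr_ae (by filter_upwards [hu] with ρ hρ using by rw [hρ])
  have hright : ∫ ρ, φ ρ • g ρ ∂torusMeasure = ∫ ρ, φ ρ • g' ρ ∂torusMeasure :=
    integral_congr_ae (by filter_upwards [hg] with ρ hρ using by rw [hρ])
  rw [← hleft, ← hright, h φ hφ hper]

lemma clm_apply [CompleteSpace E] [CompleteSpace F] {u g : L2 E} (h : IsWeakDeriv u g)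
    (L : E →L[ℝ] F) : IsWeakDeriv (fun ρ => L (u ρ)) (fun ρ => L (g ρ)) := by
  intro φ hφ hper
  simp only [← map_smul]
  rw [L.integral_comp_comm (integrable_smul_L2 (hφ.continuous_deriv (by simp)) _),
    L.integral_comp_comm (integrable_smul_L2 hφ.continuous _), ← map_neg]
  exact congrArg L (h φ hφ hper)

lemma const [CompleteSpace E] (c : E) : IsWeakDeriv (fun _ => c) fun _ => 0 := by
  intro φ hφ hper
  rw [integral_smul_const, ← intervalIntegral.integral_of_le zero_le_one,
    intervalIntegral.integral_deriv_eq_sub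
      (fun ρ _ => (hφ.differentiable (by simp)).differentiableAt)
      ((hφ.continuous_deriv (by simp)).intervalIntegrable _ _), hper.eq]
  simp

end IsWeakDeriv

namespace H1

/-- The inclusion `H¹(𝕋; E) → L²(𝕋; E)`. -/
noncomputable def fnL : H1 E →L[ℝ] L2 E :=
  WithLp.fstL 2 ℝ (L2 E) (L2 E) ∘L (H1 E).subtypeL

/-- The weak derivative `∂_ρ` as an operator `H¹(𝕋; E) → L²(𝕋; E)`. -/
noncomputable def dρL : H1 E →L[ℝ] L2 E :=
  WithLp.sndL 2 ℝ (L2 E) (L2 E) ∘L (H1 E).subtypeL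

lemma coeFn_fnL (u : H1 E) : ⇑(fnL u) = fn u := rfl

lemma coeFn_dρL (u : H1 E) : ⇑(dρL u) = dρ u := rfl

lemma memLp_dρ (u : H1 E) : MemLp (dρ u) 2 torusMeasure := Lp.memLp (dρL u)

lemma integrable_dρ (u : H1 E) : Integrable (dρ u) torusMeasure :=
  (memLp_dρ u).integrable one_le_two

lemma dρ_add_smul (u v : H1 E) (t : ℝ) :
    dρ (u + t • v) =ᵐ[torusMeasure] fun ρ => dρ u ρ + t • dρ v ρ := by
  have hmap : dρ (u + t • v) = ⇑(dρL u + t • dρL v) := by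
    rw [← coeFn_dρL, map_add, map_smul]
  rw [hmap]
  filter_upwards [Lp.coeFn_add (dρL u) (t • dρL v), Lp.coeFn_smul t (dρL v)] with ρ hadd hsmul
  rw [hadd, Pi.add_apply, hsmul, Pi.smul_apply, coeFn_dρL, coeFn_dρL]

lemma dist_dρL_le (u v : H1 E) : dist (dρL u) (dρL v) ≤ dist u v := by
  rw [dist_eq_norm, ← map_sub, dist_eq_norm]
  exact WithLp.norm_snd_le _ _

lemma integral_norm_dρ_sub_le (u v : H1 E) :
    ∫ ρ, ‖dρ u ρ - dρ v ρ‖ ∂torusMeasure ≤ dist u v := by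
  have hmeas : AEStronglyMeasurable (fun ρ => dρ u ρ - dρ v ρ) torusMeasure :=
    (integrable_dρ u).1.sub (integrable_dρ v).1
  refine le_trans ?_ (dist_dρL_le u v)
  rw [integral_norm_eq_lintegral_enorm hmeas, ← eLpNorm_one_eq_lintegral_enorm, Lp.dist_def]
  exact ENNReal.toReal_mono ((memLp_dρ u).sub (memLp_dρ v)).eLpNorm_ne_top
    (eLpNorm_le_eLpNorm_of_exponent_le one_le_two hmeas)

/-- The composition `L ∘ u` of an `H¹` function with a continuous linear map. -/
noncomputable def map [CompleteSpace E] [CompleteSpace F] (L : E →L[ℝ] F) : H1 E →L[ℝ] H1 F :=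
  ((WithLp.prodContinuousLinearEquiv 2 ℝ (L2 F) (L2 F)).symm.toContinuousLinearMap ∘L
    ((L.compLpL 2 torusMeasure ∘L fnL).prod (L.compLpL 2 torusMeasure ∘L dρL))).codRestrict (H1 F)
    fun u => (u.2.clm_apply L).congr_ae (L.coeFn_compLpL (fnL u)).symm
      (L.coeFn_compLpL (dρL u)).symm

lemma fn_map [CompleteSpace E] [CompleteSpace F] (L : E →L[ℝ] F) (u : H1 E) :
    fn (map L u) =ᵐ[torusMeasure] fun ρ => L (fn u ρ) :=
  L.coeFn_compLpL (fnL u)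

lemma dρ_map [CompleteSpace E] [CompleteSpace F] (L : E →L[ℝ] F) (u : H1 E) :
    dρ (map L u) =ᵐ[torusMeasure] fun ρ => L (dρ u ρ) :=
  L.coeFn_compLpL (dρL u)

/-- The constant function with value `c`, as an element of `H¹(𝕋; E)`. -/
noncomputable def const [CompleteSpace E] (c : E) : H1 E :=
  ⟨WithLp.toLp 2 (Lp.const 2 torusMeasure c, 0), (IsWeakDeriv.const c).congr_ae
    (Lp.coeFn_const 2 torusMeasure c).symm (Lp.coeFn_zero E 2 torusMeasure).symm⟩

lemma fn_const [CompleteSpace E] (c : E) : fn (const c) =ᵐ[torusMeasure] fun _ => c :=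
  Lp.coeFn_const 2 torusMeasure c

lemma dρ_const [CompleteSpace E] (c : E) : dρ (const c) =ᵐ[torusMeasure] 0 :=
  Lp.coeFn_zero E 2 torusMeasure

end H1

end Sobolev

section IntegrationByParts

open Complex

lemma integral_smul_eq_re_add_im {E : Type} [NormedAddCommGroup E] [NormedSpace ℂ E] {ψ : ℝ → ℂ}
    (hψ : Continuous ψ) (v : L2 E) :
    ∫ ρ, ψ ρ • v ρ ∂torusMeasure =
      ∫ ρ, (ψ ρ).re • v ρ ∂torusMeasure + I • ∫ ρ, (ψ ρ).im • v ρ ∂torusMeasure := by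
  have hre : Integrable (fun ρ => (ψ ρ).re • v ρ) torusMeasure :=
    integrable_smul_L2 (continuous_re.comp hψ) v
  have him : Integrable (fun ρ => I • (ψ ρ).im • v ρ) torusMeasure :=
    (integrable_smul_L2 (continuous_im.comp hψ) v).smul I
  rw [← integral_smul, ← integral_add hre him]
  refine integral_congr_ae (Eventually.of_forall fun ρ => ?_)
  beta_reduce
  rw [← coe_smul (ψ ρ).re, ← coe_smul (ψ ρ).im, smul_smul, ← add_smul, mul_comm I, re_add_im]

lemma IsWeakDeriv.integral_deriv_smul_eq_neg {E : Type} [NormedAddCommGroup E] [NormedSpace ℂ E]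
    {u g : L2 E} (h : IsWeakDeriv u g) {ψ : ℝ → ℂ} (hψ : ContDiff ℝ ∞ ψ)
    (hper : Function.Periodic ψ 1) :
    ∫ ρ, deriv ψ ρ • u ρ ∂torusMeasure = -∫ ρ, ψ ρ • g ρ ∂torusMeasure := by
  have hdiff : ∀ ρ, HasDerivAt ψ (deriv ψ ρ) ρ := fun ρ =>
    (hψ.differentiable (by simp) ρ).hasDerivAt
  have hre : deriv (fun ρ => (ψ ρ).re) = fun ρ => (deriv ψ ρ).re := funext fun ρ =>
    (reCLM.hasFDerivAt.comp_hasDerivAt ρ (hdiff ρ)).deriv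
  have him : deriv (fun ρ => (ψ ρ).im) = fun ρ => (deriv ψ ρ).im := funext fun ρ =>
    (imCLM.hasFDerivAt.comp_hasDerivAt ρ (hdiff ρ)).deriv
  have hre_test := h (fun ρ => (ψ ρ).re) (reCLM.contDiff.comp hψ) (hper.comp re)
  have him_test := h (fun ρ => (ψ ρ).im) (imCLM.contDiff.comp hψ) (hper.comp im)
  rw [hre] at hre_test
  rw [him] at him_test
  rw [integral_smul_eq_re_add_im (hψ.continuous_deriv (by simp)),
    integral_smul_eq_re_add_im hψ.continuous, hre_test, him_test, smul_neg, neg_add]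

lemma fourierCoeffOn_zero_one (f : ℝ → ℂ) (n : ℤ) :
    fourierCoeffOn zero_lt_one f n =
      ∫ ρ, exp (-(2 * Real.pi * n * I) * ρ) • f ρ ∂torusMeasure := by
  rw [fourierCoeffOn_eq_integral, intervalIntegral.integral_of_le zero_le_one, sub_zero, div_one,
    one_smul]
  refine integral_congr_ae (Eventually.of_forall fun ρ => ?_)
  simp only [fourier_coe_apply]
  congr 2
  push_cast
  ring

lemma IsWeakDeriv.fourierCoeffOn {u g : L2 ℂ} (h : IsWeakDeriv u g) (n : ℤ) :
    fourierCoeffOn zero_lt_one g n = 2 * Real.pi * n * I * fourierCoeffOn zero_lt_one u n := by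
  set c : ℂ := -(2 * Real.pi * n * I) with hc
  have hsmooth : ContDiff ℝ ∞ fun ρ : ℝ => exp (c * ρ) :=
    (contDiff_const.mul ofRealCLM.contDiff).cexp
  have hper : Function.Periodic (fun ρ : ℝ => exp (c * ρ)) 1 := fun ρ => by
    rw [exp_eq_exp_iff_exists_int]
    exact ⟨-n, by push_cast; rw [hc]; ring⟩
  have hderiv : deriv (fun ρ : ℝ => exp (c * ρ)) = fun ρ : ℝ => c • exp (c * ρ) := by
    ext ρ
    have hexp := ((hasDerivAt_id' (ρ : ℂ)).const_mul c).cexp.comp_ofReal.deriv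
    rwa [mul_one, mul_comm] at hexp
  have htest := h.integral_deriv_smul_eq_neg hsmooth hper
  simp only [hderiv, smul_assoc, integral_smul] at htest
  rw [fourierCoeffOn_zero_one, fourierCoeffOn_zero_one, ← hc, eq_comm, ← neg_inj, ← htest, hc,
    smul_eq_mul, neg_mul]

lemma fourierCoeffOn_add_smul (v w : L2 ℂ) (c : ℝ) (n : ℤ) :
    fourierCoeffOn zero_lt_one (v + c • w : L2 ℂ) n =
      fourierCoeffOn zero_lt_one v n + c * fourierCoeffOn zero_lt_one w n := by
  have hint : ∀ f : L2 ℂ,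
      Integrable (fun ρ : ℝ => exp (-(2 * Real.pi * n * I) * ρ) • f ρ) torusMeasure := fun f =>
    ((Lp.memLp f).integrable one_le_two).bdd_smul 1
      (φ := fun ρ : ℝ => exp (-(2 * Real.pi * n * I) * ρ))
      (by fun_prop) (Eventually.of_forall fun ρ => by simp [norm_exp])
  rw [fourierCoeffOn_zero_one, fourierCoeffOn_zero_one, fourierCoeffOn_zero_one,
    ← integral_const_mul, ← integral_add (hint v) ((hint w).const_mul _)]
  refine integral_congr_ae ?_
  filter_upwards [Lp.coeFn_add v (c • w), Lp.coeFn_smul c w] with ρ hadd hsmul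
  rw [hadd, Pi.add_apply, hsmul, Pi.smul_apply, smul_eq_mul, smul_eq_mul, smul_eq_mul, real_smul]
  ring

lemma norm_sq_eq_tsum_fourierCoeffOn (v : L2 ℂ) :
    ‖v‖ ^ 2 = ∑' n : ℤ, ‖fourierCoeffOn zero_lt_one v n‖ ^ 2 := by
  rw [tsum_sq_fourierCoeffOn zero_lt_one (Lp.memLp v), ← real_inner_self_eq_norm_sq,
    L2.inner_def, intervalIntegral.integral_of_le zero_le_one]
  simp

namespace H1

/-- The Fourier coefficients of `u + u'` and `u - u'` have the same modulus, so Parseval's identity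
makes `u` and `u'` orthogonal. -/
lemma inner_fnL_dρL_self_complex (u : H1 ℂ) : inner ℝ (fnL u) (dρL u) = 0 := by
  have hcoeff : ∀ (c : ℝ) (n : ℤ), ‖fourierCoeffOn zero_lt_one (fnL u + c • dρL u : L2 ℂ) n‖ =
      ‖(1 + (c * (2 * Real.pi * n) : ℝ) * I : ℂ)‖ * ‖fourierCoeffOn zero_lt_one (fnL u) n‖ := by
    intro c n
    have hderiv : fourierCoeffOn zero_lt_one (dρL u) n =
        2 * Real.pi * n * I * fourierCoeffOn zero_lt_one (fnL u) n :=
      IsWeakDeriv.fourierCoeffOn u.2 n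
    rw [fourierCoeffOn_add_smul, hderiv, ← norm_mul]
    congr 1
    push_cast
    ring
  have hnorm : ‖fnL u + (1 : ℝ) • dρL u‖ ^ 2 = ‖fnL u + (-1 : ℝ) • dρL u‖ ^ 2 := by
    simp only [norm_sq_eq_tsum_fourierCoeffOn, hcoeff]
    refine tsum_congr fun n => ?_
    congr 2
    rw [← norm_conj, map_add, map_mul, conj_ofReal, conj_I, map_one]
    congr 2
    push_cast
    ring
  rw [one_smul, neg_one_smul, ← sub_eq_add_neg, norm_add_sq_real, norm_sub_sq_real] at hnorm
  linarith

lemma inner_fnL_dρL_self (u : H1 ℝ) : inner ℝ (fnL u) (dρL u) = 0 := by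
  have h := inner_fnL_dρL_self_complex (map ofRealCLM u)
  rw [L2.inner_def] at h ⊢
  rw [← h]
  refine integral_congr_ae ?_
  filter_upwards [fn_map ofRealCLM u, dρ_map ofRealCLM u] with ρ hfn hdρ
  rw [coeFn_fnL, coeFn_dρL, coeFn_fnL, coeFn_dρL, hfn, hdρ]
  simp

lemma inner_fnL_dρL (u v : H1 ℝ) : inner ℝ (fnL u) (dρL v) = -inner ℝ (fnL v) (dρL u) := by
  have h := inner_fnL_dρL_self (u + v)
  simp only [map_add, inner_add_left, inner_add_right, inner_fnL_dρL_self] at h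
  linarith

end H1

end IntegrationByParts
section Area

/-- Counterclockwise rotation by `π/2`, the map `v ↦ -v^⊥` that turns the tangent of a curve into
its normal. -/
noncomputable def rot : Plane →ₗᵢ[ℝ] Plane where
  toFun v := -perp v
  map_add' v w := by
    ext i
    fin_cases i <;> simp [perp, add_comm]
  map_smul' c v := by
    ext i
    fin_cases i <;> simp [perp]
  norm_map' v := by simp [perp, EuclideanSpace.norm_eq, Fin.sum_univ_two, add_comm]

lemma rot_apply_zero (v : Plane) : rot v 0 = -v 1 := rfl

lemma rot_apply_one (v : Plane) : rot v 1 = v 0 := neg_neg (v 0)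

lemma normal_eq_rot_ds (X : H1 Plane) (ρ : ℝ) : normal X ρ = rot (ds X X ρ) := rfl

lemma arcDensity_smul_normal (X : H1 Plane) (ρ : ℝ) :
    arcDensity X ρ • normal X ρ = rot (dρ X ρ) := by
  rcases eq_or_ne (dρ X ρ) 0 with h | h
  · simp [arcDensity, h]
  · rw [normal_eq_rot_ds, ds, map_smul, arcDensity, smul_inv_smul₀ (norm_ne_zero_iff.2 h)]

namespace H1

/-- The `i`-th coordinate of a plane curve. -/
noncomputable def coord (i : Fin 2) : H1 Plane →L[ℝ] H1 ℝ := map (EuclideanSpace.proj i)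

lemma fn_coord (i : Fin 2) (X : H1 Plane) : fn (coord i X) =ᵐ[torusMeasure] fun ρ => fn X ρ i :=
  fn_map _ X

lemma dρ_coord (i : Fin 2) (X : H1 Plane) : dρ (coord i X) =ᵐ[torusMeasure] fun ρ => dρ X ρ i :=
  dρ_map _ X

end H1

lemma area_eq_inner (X : H1 Plane) :
    area X = inner ℝ (H1.fnL (H1.coord 1 X)) (H1.dρL (H1.coord 0 X)) := by
  rw [area, L2.inner_def]
  refine integral_congr_ae ?_
  filter_upwards [H1.fn_coord 1 X, H1.dρ_coord 0 X] with ρ hfn hdρ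
  rw [H1.coeFn_fnL, H1.coeFn_dρL, hfn, hdρ, Real.inner_apply, mul_comm]

lemma locallyLipschitz_area : LocallyLipschitz area := by
  rw [funext area_eq_inner]
  have hcont : ContDiff ℝ 1 fun X : H1 Plane =>
      inner ℝ (H1.fnL (H1.coord 1 X)) (H1.dρL (H1.coord 0 X)) :=
    (H1.fnL.contDiff.comp (H1.coord 1).contDiff).inner ℝ
      (H1.dρL.contDiff.comp (H1.coord 0).contDiff)
  exact hcont.locallyLipschitz

lemma hasLineDerivAt_area (X V : H1 Plane) :
    HasLineDerivAt ℝ area (∫ ρ, inner ℝ (normal X ρ) (fn V ρ) * arcDensity X ρ ∂torusMeasure)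
      X V := by
  have hcurve : ∀ L : H1 Plane →L[ℝ] L2 ℝ, HasDerivAt (fun t : ℝ => L (X + t • V)) (L V) 0 :=
    fun L => L.hasFDerivAt.hasLineDerivAt V
  have hinner := (hcurve (H1.fnL ∘L H1.coord 1)).inner ℝ (hcurve (H1.dρL ∘L H1.coord 0))
  simp only [ContinuousLinearMap.comp_apply, zero_smul, add_zero] at hinner
  rw [HasLineDerivAt, funext fun t : ℝ => area_eq_inner (X + t • V)]
  refine hinner.congr_deriv ?_
  rw [H1.inner_fnL_dρL, neg_add_eq_sub, L2.inner_def, L2.inner_def,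
    ← integral_sub (L2.integrable_inner _ _) (L2.integrable_inner _ _)]
  refine integral_congr_ae ?_
  filter_upwards [H1.fn_coord 0 V, H1.fn_coord 1 V, H1.dρ_coord 0 X, H1.dρ_coord 1 X]
    with ρ hV₀ hV₁ hX₀ hX₁
  rw [mul_comm, ← real_inner_smul_left, arcDensity_smul_normal]
  simp only [H1.coeFn_fnL, H1.coeFn_dρL, hV₀, hV₁, hX₀, hX₁, Real.inner_apply, PiLp.inner_apply,
    Fin.sum_univ_two, rot_apply_zero, rot_apply_one]
  ring

lemma WeakEquations.hasLineDerivAt_area {γ k : Plane → ℝ} {X V : H1 Plane} {μ : H1 ℝ}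
    (h : WeakEquations γ k X V μ) : HasLineDerivAt ℝ area 0 X V := by
  have htest := h.1 (H1.const 1)
  have hnormal : curveInner X (fun ρ => inner ℝ (normal X ρ) (fn V ρ)) (fn (H1.const (1 : ℝ))) =
      ∫ ρ, inner ℝ (normal X ρ) (fn V ρ) * arcDensity X ρ ∂torusMeasure := by
    refine integral_congr_ae ?_
    filter_upwards [H1.fn_const (1 : ℝ)] with ρ hρ
    rw [hρ, Real.inner_apply, mul_one]
  have hdiffusion : curveInner X (ds X μ) (ds X (H1.const (1 : ℝ))) = 0 := by
    refine integral_eq_zero_of_ae ?_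
    filter_upwards [H1.dρ_const (1 : ℝ)] with ρ hρ
    simp [ds, hρ]
  rw [hnormal, hdiffusion, add_zero] at htest
  exact htest ▸ SurfaceDiffusion.hasLineDerivAt_area X V

end Area

section Energy

variable {γ k : Plane → ℝ}

lemma isPosHomogeneous_homExt (γ : Plane → ℝ) : IsPosHomogeneous (homExt γ) := by
  intro c hc p
  rw [homExt, homExt, norm_smul, Real.norm_of_nonneg hc.le, mul_inv_rev, mul_smul,
    inv_smul_smul₀ hc.ne', smul_eq_mul, mul_assoc]

lemma homExt_of_norm_eq_one {n : Plane} (hn : ‖n‖ = 1) : homExt γ n = γ n := by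
  rw [homExt, hn, inv_one, one_smul, one_mul]

lemma inner_cahnHoffman_self {n : Plane} (hn : ‖n‖ = 1) (hγ : DifferentiableAt ℝ (homExt γ) n) :
    inner ℝ (cahnHoffman γ n) n = γ n := by
  rw [cahnHoffman, inner_gradient_left, (isPosHomogeneous_homExt γ).fderiv_apply_self hγ,
    homExt_of_norm_eq_one hn]

lemma toEuclideanLin_surfaceEnergyMatrix (γ k : Plane → ℝ) (n v : Plane) :
    Matrix.toEuclideanLin (surfaceEnergyMatrix γ k n) v =
      γ n • v - inner ℝ (cahnHoffman γ n) v • n + inner ℝ n v • cahnHoffman γ n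
        + (k n * inner ℝ n v) • n := by
  ext i
  simp [surfaceEnergyMatrix, Matrix.toLpLin_apply, Matrix.vecMulVec_mulVec, PiLp.inner_apply,
    dotProduct, mul_comm, mul_left_comm]

lemma inner_rot_self (v : Plane) : inner ℝ (rot v) v = 0 := by
  simp only [PiLp.inner_apply, Fin.sum_univ_two, rot_apply_zero, rot_apply_one, Real.inner_apply]
  ring

lemma rot_eq_of_norm_eq_one {τ : Plane} (hτ : ‖τ‖ = 1) (v : Plane) :
    rot v = inner ℝ τ v • rot τ - inner ℝ (rot τ) v • τ := by
  have hsq : τ 0 ^ 2 + τ 1 ^ 2 = 1 := by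
    rw [← Fin.sum_univ_two fun i => τ i ^ 2, ← EuclideanSpace.real_norm_sq_eq, hτ, one_pow]
  ext i
  fin_cases i
  · simp only [Fin.zero_eta, rot_apply_zero, PiLp.inner_apply, Real.inner_apply, Fin.sum_univ_two,
      rot_apply_one, PiLp.sub_apply, PiLp.smul_apply, smul_eq_mul]
    linear_combination v 1 * hsq
  · simp only [Fin.mk_one, rot_apply_one, PiLp.inner_apply, Real.inner_apply, Fin.sum_univ_two,
      rot_apply_zero, PiLp.sub_apply, PiLp.smul_apply, smul_eq_mul]
    linear_combination -v 0 * hsq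

/-- The stabilizing term `k n nᵀ` is invisible here because `τ` is orthogonal to `rot τ`. -/
lemma inner_surfaceEnergyMatrix_tangent {τ : Plane} (hτ : ‖τ‖ = 1)
    (hγ : DifferentiableAt ℝ (homExt γ) (rot τ)) (v : Plane) :
    inner ℝ (Matrix.toEuclideanLin (surfaceEnergyMatrix γ k (rot τ)) τ) v =
      inner ℝ (cahnHoffman γ (rot τ)) (rot v) := by
  have heuler : inner ℝ (cahnHoffman γ (rot τ)) (rot τ) = γ (rot τ) :=
    inner_cahnHoffman_self ((rot.norm_map τ).trans hτ) hγ
  rw [toEuclideanLin_surfaceEnergyMatrix, inner_rot_self, rot_eq_of_norm_eq_one hτ v]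
  simp only [inner_add_left, inner_sub_left, inner_sub_right, real_inner_smul_left,
    real_inner_smul_right, heuler]
  ring

lemma energy_eq_integral_homExt (γ : Plane → ℝ) (X : H1 Plane) :
    energy γ X = ∫ ρ, homExt γ (rot (dρ X ρ)) ∂torusMeasure := by
  refine integral_congr_ae (Eventually.of_forall fun ρ => ?_)
  simp only [homExt, normal_eq_rot_ds, ds, arcDensity, map_smul, rot.norm_map, mul_comm]

lemma integrable_rot_dρ (X : H1 Plane) : Integrable (fun ρ => rot (dρ X ρ)) torusMeasure :=
  rot.toContinuousLinearMap.integrable_comp (H1.integrable_dρ X)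

lemma exists_lipschitzWith_energy (hγ : ContDiffOn ℝ 1 (homExt γ) {0}ᶜ) :
    ∃ L : ℝ≥0, LipschitzWith L (energy γ) := by
  obtain ⟨L, hL⟩ := (isPosHomogeneous_homExt γ).exists_lipschitzWith hγ
  refine ⟨L, LipschitzWith.of_dist_le_mul fun X Y => ?_⟩
  rw [energy_eq_integral_homExt, energy_eq_integral_homExt]
  calc _ ≤ L * ∫ ρ, ‖rot (dρ X ρ) - rot (dρ Y ρ)‖ ∂torusMeasure :=
        dist_integral_comp_le hL (isPosHomogeneous_homExt γ).map_zero (integrable_rot_dρ X)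
          (integrable_rot_dρ Y)
    _ = L * ∫ ρ, ‖dρ X ρ - dρ Y ρ‖ ∂torusMeasure := by simp only [← map_sub, rot.norm_map]
    _ ≤ L * dist X Y := by gcongr; exact H1.integral_norm_dρ_sub_le X Y

lemma hasLineDerivAt_homExt_rot (hγ : ContDiffOn ℝ 1 (homExt γ) {0}ᶜ) {X : H1 Plane} {ρ : ℝ}
    (hX : dρ X ρ ≠ 0) (V : H1 Plane) :
    HasLineDerivAt ℝ (homExt γ)
      (inner ℝ (Matrix.toEuclideanLin (surfaceEnergyMatrix γ k (normal X ρ)) (ds X X ρ)) (ds X V ρ)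
        * arcDensity X ρ) (rot (dρ X ρ)) (rot (dρ V ρ)) := by
  have hdiff : ∀ p ≠ 0, DifferentiableAt ℝ (homExt γ) p := fun p hp =>
    (hγ.differentiableOn one_ne_zero).differentiableAt (isOpen_compl_singleton.mem_nhds hp)
  have hpos : 0 < arcDensity X ρ := norm_pos_iff.2 hX
  have htangent : ‖ds X X ρ‖ = 1 := norm_smul_inv_norm hX
  have hrot : ∀ p : Plane, p ≠ 0 → rot p ≠ 0 := fun p hp => (map_ne_zero_iff rot rot.injective).2 hp
  have hscale : fderiv ℝ (homExt γ) (rot (dρ X ρ)) = fderiv ℝ (homExt γ) (normal X ρ) := by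
    rw [← arcDensity_smul_normal, (isPosHomogeneous_homExt γ).fderiv_smul hpos]
  refine ((hdiff _ (hrot _ hX)).hasFDerivAt.hasLineDerivAt (rot (dρ V ρ))).congr_deriv ?_
  rw [hscale, ← inner_gradient_left, ← cahnHoffman, normal_eq_rot_ds,
    ← inner_surfaceEnergyMatrix_tangent htangent
      (hdiff _ (hrot _ (norm_ne_zero_iff.1 (htangent.trans_ne one_ne_zero)))), ds, ds,
    real_inner_smul_right, mul_right_comm, inv_mul_cancel₀ hpos.ne', one_mul]

lemma hasLineDerivAt_energy (hγ : ContDiffOn ℝ 1 (homExt γ) {0}ᶜ) {X : H1 Plane}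
    (hX : ∀ᵐ ρ ∂torusMeasure, dρ X ρ ≠ 0) (V : H1 Plane) :
    HasLineDerivAt ℝ (energy γ)
      (curveInner X
        (fun ρ => Matrix.toEuclideanLin (surfaceEnergyMatrix γ k (normal X ρ)) (ds X X ρ))
        (ds X V)) X V := by
  obtain ⟨L, hL⟩ := (isPosHomogeneous_homExt γ).exists_lipschitzWith hγ
  have hvariation : ∀ t : ℝ, energy γ (X + t • V) =
      ∫ ρ, homExt γ (rot (dρ X ρ) + t • rot (dρ V ρ)) ∂torusMeasure := by
    intro t
    rw [energy_eq_integral_homExt]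
    refine integral_congr_ae ?_
    filter_upwards [H1.dρ_add_smul X V t] with ρ hρ
    rw [hρ, map_add, map_smul]
  rw [HasLineDerivAt, funext hvariation]
  refine hasDerivAt_integral_comp_add_smul hL (isPosHomogeneous_homExt γ).map_zero
    (integrable_rot_dρ X) (integrable_rot_dρ V) ?_
  filter_upwards [hX] with ρ hρ using hasLineDerivAt_homExt_rot hγ hρ V

lemma curveInner_self_nonneg {F : Type} [NormedAddCommGroup F] [InnerProductSpace ℝ F]
    (X : H1 Plane) (u : ℝ → F) : 0 ≤ curveInner X u u :=
  integral_nonneg fun _ => mul_nonneg real_inner_self_nonneg (norm_nonneg _)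

namespace WeakEquations

variable {X V : H1 Plane} {μ : H1 ℝ}

lemma curveInner_surfaceEnergyMatrix (h : WeakEquations γ k X V μ) :
    curveInner X (fun ρ => Matrix.toEuclideanLin (surfaceEnergyMatrix γ k (normal X ρ)) (ds X X ρ))
      (ds X V) = -curveInner X (ds X μ) (ds X μ) := by
  have hswap : curveInner X (fun ρ => fn μ ρ • normal X ρ) (fn V) =
      curveInner X (fun ρ => inner ℝ (normal X ρ) (fn V ρ)) (fn μ) := by
    simp only [curveInner, real_inner_smul_left, Real.inner_apply, mul_comm]
  rw [← sub_eq_zero.1 (h.2 V), hswap, eq_neg_of_add_eq_zero_left (h.1 μ)]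

lemma hasLineDerivAt_energy (h : WeakEquations γ k X V μ)
    (hγ : ContDiffOn ℝ 1 (homExt γ) {0}ᶜ) (hX : ∀ᵐ ρ ∂torusMeasure, dρ X ρ ≠ 0) :
    HasLineDerivAt ℝ (energy γ) (-curveInner X (ds X μ) (ds X μ)) X V :=
  h.curveInner_surfaceEnergyMatrix ▸ SurfaceDiffusion.hasLineDerivAt_energy hγ hX V

end WeakEquations

end Energy

namespace IsWeakSolution

variable {γ k : Plane → ℝ} {X : ℝ → H1 Plane} {μ : ℝ → H1 ℝ}

lemma ae_dρ_ne_zero (h : IsWeakSolution γ k X μ) {t : ℝ} (ht : 0 ≤ t) :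
    ∀ᵐ ρ ∂torusMeasure, dρ (X t) ρ ≠ 0 := by
  obtain ⟨C, hC, hreg⟩ := h.regular
  filter_upwards [hreg t ht] with ρ hρ
  exact norm_pos_iff.1 ((one_div_pos.2 (one_pos.trans hC)).trans_le hρ.1)

lemma area_eq (h : IsWeakSolution γ k X μ) {t : ℝ} (ht : 0 ≤ t) : area (X t) = area (X 0) := by
  obtain ⟨V, hV, heq⟩ := h.equations
  have hconst : ∀ a b, 0 < a → a ≤ b → area (X b) = area (X a) := by
    intro a b ha hab
    rw [← sub_eq_zero, hV.sub_eq_integral locallyLipschitz_area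
      (heq.mono fun t ht => ht.hasLineDerivAt_area) ha hab, intervalIntegral.integral_zero]
  have hone : EqOn (fun t => area (X t)) (fun _ => area (X 1)) (Ioi 0) := fun s hs =>
    (le_total s 1).elim (fun hs1 => (hconst s 1 hs hs1).symm) (hconst 1 s one_pos)
  have hclosure : EqOn (fun t => area (X t)) (fun _ => area (X 1)) (Ici 0) :=
    hone.of_subset_closure (locallyLipschitz_area.continuous.comp_continuousOn h.continuousOn)
      continuousOn_const Ioi_subset_Ici_self (closure_Ioi (0 : ℝ)).ge
  exact (hclosure ht).trans (hclosure self_mem_Ici).symm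

lemma antitoneOn_energy (h : IsWeakSolution γ k X μ) (hγ : ContDiffOn ℝ 1 (homExt γ) {0}ᶜ) :
    AntitoneOn (fun t => energy γ (X t)) (Ici 0) := by
  obtain ⟨V, hV, heq⟩ := h.equations
  obtain ⟨L, hL⟩ := exists_lipschitzWith_energy hγ
  refine antitoneOn_Ici_of_Ioi (hL.continuous.comp_continuousOn h.continuousOn)
    fun a ha b _ hab => ?_
  have hdissipation : ∀ᵐ t ∂volume.restrict (Ioi 0), HasLineDerivAt ℝ (energy γ)
      (-curveInner (X t) (ds (X t) (μ t)) (ds (X t) (μ t))) (X t) (V t) := by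
    filter_upwards [heq, ae_restrict_mem measurableSet_Ioi] with t heqt ht
    exact heqt.hasLineDerivAt_energy hγ (h.ae_dρ_ne_zero (mem_Ioi.1 ht).le)
  rw [← sub_nonpos, hV.sub_eq_integral hL.locallyLipschitz hdissipation ha hab,
    intervalIntegral.integral_neg, neg_nonpos]
  exact intervalIntegral.integral_nonneg hab fun t _ => curveInner_self_nonneg _ _

end IsWeakSolution

end SurfaceDiffusion

open SurfaceDiffusion in
theorem mainTheorem9_general {γ k : Plane → ℝ} (hγ : ContDiffOn ℝ 1 (homExt γ) {0}ᶜ)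
    {X : ℝ → H1 Plane} {μ : ℝ → H1 ℝ} (hsol : IsWeakSolution γ k X μ) :
    (∀ t : ℝ, 0 ≤ t → area (X t) = area (X 0)) ∧
      AntitoneOn (fun t => energy γ (X t)) (Set.Ici 0) :=
  ⟨fun _ ht => hsol.area_eq ht, hsol.antitoneOn_energy hγ⟩

theorem mainTheorem9
    (γ k : SurfaceDiffusion.Plane → ℝ)
    (hγ : ContDiffOn ℝ 1 (SurfaceDiffusion.homExt γ) {0}ᶜ)
    (hk : ∀ n : SurfaceDiffusion.Plane, ‖n‖ = 1 → 0 ≤ k n)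
    (X : ℝ → SurfaceDiffusion.H1 SurfaceDiffusion.Plane)
    (μ : ℝ → SurfaceDiffusion.H1 ℝ)
    (hsol : SurfaceDiffusion.IsWeakSolution γ k X μ) :
    (∀ t : ℝ, 0 ≤ t → SurfaceDiffusion.area (X t) = SurfaceDiffusion.area (X 0)) ∧
    (∀ t₁ t : ℝ, 0 ≤ t₁ → t₁ ≤ t →
      SurfaceDiffusion.energy γ (X t) ≤ SurfaceDiffusion.energy γ (X t₁) ∧
      SurfaceDiffusion.energy γ (X t₁) ≤ SurfaceDiffusion.energy γ (X 0)) := by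
  obtain ⟨harea, henergy⟩ := mainTheorem9_general hγ hsol
  exact ⟨harea, fun t₁ t h₁ ht => ⟨henergy h₁ (h₁.trans ht) ht, henergy Set.self_mem_Ici h₁ h₁⟩⟩
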